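/- For $v=(a,b,c,d)\in\mathbb C^4$ let \[ |G_{abcd}\rangle=\tfrac{a+d}{2}\big(|0000\rangle+|1111\rangle\big)+\tfrac{a-d}{2}\big(|0011\rangle+|1100\rangle\big)+\tfrac{b+c}{2}\big(|0101\rangle+|1010\rangle\big)+\tfrac{b-c}{2}\big(|0110\rangle+|1001\rangle\big)\in(\mathbb C^2)^{\otimes 4}. \] Two vectors $\psi,\varphi\in(\mathbb C^2)^{\otimes 4}$ are called SLOCC-equivalent if $\varphi=\kappa\,(A_1\otimes A_2\otimes A_3\otimes A_4)\psi$ for some $A_1,\dots,A_4\in SL(2,\mathbb C)$ and some $\kappa\in\mathbb C\setminus\{0\}$. Let $W$ be the group of linear maps of $\mathbb C^4$ generated by all permutations of the four coordinates and all changes of sign of two of the four coordinates. Let $(a,b,c,d)\in\mathbb C^4$ be such that $a^2,b^2,c^2,d^2$ are pairwise distinct. Then: 1. For every $(a',b',c',d')\in\mathbb C^4$ such that $|G_{a'b'c'd'}\rangle$ and $|G_{abcd}\rangle$ have the same norm (in particular if both are normalized), $|G_{abcd}\rangle$ and $|G_{a'b'c'd'}\rangle$ are SLOCC-equivalent if and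 only if $(a',b',c',d')=e^{i\theta}\,w(a,b,c,d)$ for some $\theta\in\mathbb R$ and some $w\in W$. 2. The tuples $(a',b',c',d')\in\mathbb C^4$ for which $|G_{a'b'c'd'}\rangle=(A_1\otimes A_2\otimes A_3\otimes A_4)|G_{abcd}\rangle$ for some $A_1,\dots,A_4\in SL(2,\mathbb C)$ are precisely the tuples $w(a,b,c,d)$ with $w\in W$, and there are exactly $192$ of them. 3. $W$ is the Weyl group of type $D_4$, that is, the group generated by the reflections in the vectors $\pm e_i\pm e_j$, $i\neq j$. -/

import Mathlib

open scoped Matrix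

namespace FourQubit

noncomputable section

/-- State vectors of `n` qubits: amplitudes in the computational basis `|i₁ … iₙ⟩`, with the
Hilbert space norm. -/
abbrev Ket (n : ℕ) : Type := EuclideanSpace ℂ (Fin n → Fin 2)

/-- The computational basis vector `|i₁ … iₙ⟩`. -/
def basisKet {n : ℕ} (i : Fin n → Fin 2) : Ket n := EuclideanSpace.single i (1 : ℂ)

/-- The matrix of the tensor product operator `A₁ ⊗ ⋯ ⊗ Aₙ` in the computational basis. -/
def tensorMatrix {n : ℕ} (A : Fin n → Matrix (Fin 2) (Fin 2) ℂ) :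
    Matrix (Fin n → Fin 2) (Fin n → Fin 2) ℂ :=
  Matrix.of fun j i => ∏ k, A k (j k) (i k)

/-- The action on state vectors of the local operator `A₁ ⊗ ⋯ ⊗ Aₙ ∈ SL(2, ℂ)^{⊗ n}`. -/
def localAct {n : ℕ} (A : Fin n → Matrix.SpecialLinearGroup (Fin 2) ℂ) (ψ : Ket n) : Ket n :=
  WithLp.toLp 2 (tensorMatrix (fun k => (A k : Matrix (Fin 2) (Fin 2) ℂ)) *ᵥ WithLp.ofLp ψ)

/-- SLOCC equivalence: `φ ∝ (A₁ ⊗ ⋯ ⊗ Aₙ) ψ` with all `Aₖ ∈ SL(2, ℂ)`. Pure states are rays, so a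
nonzero factor is allowed. -/
def SLOCCEquiv {n : ℕ} (ψ φ : Ket n) : Prop :=
  ∃ A : Fin n → Matrix.SpecialLinearGroup (Fin 2) ℂ, ∃ κ : ℂ, κ ≠ 0 ∧ φ = κ • localAct A ψ

/-- The state vector `|G_abcd⟩`, where `v = (a, b, c, d)`. -/
def gState (v : Fin 4 → ℂ) : Ket 4 :=
  ((v 0 + v 3) / 2) • (basisKet ![0, 0, 0, 0] + basisKet ![1, 1, 1, 1]) +
  ((v 0 - v 3) / 2) • (basisKet ![0, 0, 1, 1] + basisKet ![1, 1, 0, 0]) +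
  ((v 1 + v 2) / 2) • (basisKet ![0, 1, 0, 1] + basisKet ![1, 0, 1, 0]) +
  ((v 1 - v 2) / 2) • (basisKet ![0, 1, 1, 0] + basisKet ![1, 0, 0, 1])

/-- The permutations of the four coefficients. -/
def coeffPermutations : Set ((Fin 4 → ℂ) ≃ₗ[ℂ] (Fin 4 → ℂ)) :=
  {g | ∃ σ : Equiv.Perm (Fin 4), ∀ v i, g v i = v (σ i)}

/-- The changes of sign in front of two of the four coefficients. -/
def doubleSignChanges : Set ((Fin 4 → ℂ) ≃ₗ[ℂ] (Fin 4 → ℂ)) :=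
  {g | ∃ i j : Fin 4, i ≠ j ∧ ∀ v k, g v k = if k = i ∨ k = j then -v k else v k}

/-- The group of all compositions of permutations of the coefficients and changes of sign in front
of two coefficients. -/
def coeffSymmetries : Subgroup ((Fin 4 → ℂ) ≃ₗ[ℂ] (Fin 4 → ℂ)) :=
  Subgroup.closure (coeffPermutations ∪ doubleSignChanges)

/-- The roots `± eᵢ ± eⱼ`, `i ≠ j`, of the root system `D₄`. -/
def rootsD4 : Set (Fin 4 → ℂ) :=
  {α | ∃ i j : Fin 4, i ≠ j ∧ ∃ s t : ℂ, (s = 1 ∨ s = -1) ∧ (t = 1 ∨ t = -1) ∧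
    α = Pi.single i s + Pi.single j t}

/-- The Weyl group of `D₄`, acting on `ℂ⁴`: the group generated by the reflections
`v ↦ v - (2 (α ⬝ v) / (α ⬝ α)) α` in the roots `α`, where `α ⬝ α = 2`. -/
def weylGroupD4 : Subgroup ((Fin 4 → ℂ) ≃ₗ[ℂ] (Fin 4 → ℂ)) :=
  Subgroup.closure {g | ∃ α ∈ rootsD4, ∀ v, g v = v - (α ⬝ᵥ v) • α}

end

end FourQubit

/-!
The state `|G_abcd⟩`, viewed as a `4 × 4` matrix `M` across the cut `12 | 34`, is diagonal in the
Bell basis with eigenvalues `a, b, c, d`. Local operators in `SL(2, ℂ)` act as `M ↦ P M Qᵀ`, where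
`P` and `Q` have determinant one and preserve the symmetric form `J = ε ⊗ ε`. Hence `det M` and the
characteristic polynomial of `M J Mᵀ J` are invariant. The Bell basis diagonalises `J` as well, with
eigenvalues `±1`, so on `|G_abcd⟩` these invariants are `abcd` and the polynomial with roots
`a², b², c², d²` (`det_cutMatrix_gState`, `charpoly_cutMatrix_gState`). They determine `(a, b, c, d)`
up to a permutation with an even number of sign changes; should the signs come out odd, some
coordinate vanishes and its sign is free (`exists_evenSignedPerm_of_invariants`).

Conversely, the even signed permutations are generated by three transpositions and one double sign
change (`evenSignedPerms_le`). Phase gates, Hadamard gates and Pauli matrices on the four qubits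
permute the Bell vectors up to phases, and realise these generators. The same generation lemma
identifies the group of coefficient symmetries and the Weyl group of `D₄` with the even signed
permutations (`coeffSymmetries_eq`, `weylGroupD4_eq`).

An orbit has `2³ · 4!` elements, since distinct squares determine the permutation, and then the
signs at the nonzero coordinates and parity determine all signs. As the norm of `|G_abcd⟩` is that
of `(a, b, c, d)`, which signed permutations preserve, an additional scalar `κ` between states of
equal norm is a phase; it can be absorbed into the coefficients because `|G_abcd⟩` is linear in them.
-/

namespace FourQubit

open Equiv Polynomial
open scoped Kronecker

noncomputable section

/-! ### Signed permutations -/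

/-- The signed permutation `v ↦ (sᵢ v_{σ i})ᵢ` of the coordinates of `ℂ⁴`. -/
def signedPerm (s : Fin 4 → ℤˣ) (σ : Perm (Fin 4)) : (Fin 4 → ℂ) ≃ₗ[ℂ] (Fin 4 → ℂ) :=
  (LinearEquiv.funCongrLeft ℂ ℂ σ).trans
    (LinearEquiv.piCongrRight fun i => DistribMulAction.toLinearEquiv ℂ ℂ (s i))

@[simp]
theorem signedPerm_apply (s : Fin 4 → ℤˣ) (σ : Perm (Fin 4)) (v : Fin 4 → ℂ) (i : Fin 4) :
    signedPerm s σ v i = s i • v (σ i) := rfl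

theorem signedPerm_mul (s t : Fin 4 → ℤˣ) (σ τ : Perm (Fin 4)) :
    signedPerm s σ * signedPerm t τ = signedPerm (s * t ∘ σ) (τ * σ) := by
  ext1 v
  funext i
  simp [LinearEquiv.mul_apply, mul_smul]

theorem signedPerm_one : signedPerm 1 1 = 1 := by
  ext1 v
  funext i
  simp

/-- The group of signed permutations with an even number of minus signs. -/
def evenSignedPerms : Subgroup ((Fin 4 → ℂ) ≃ₗ[ℂ] (Fin 4 → ℂ)) where
  carrier := {g | ∃ s σ, ∏ i, s i = 1 ∧ g = signedPerm s σ}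
  one_mem' := ⟨1, 1, by simp, signedPerm_one.symm⟩
  mul_mem' := by
    rintro _ _ ⟨s, σ, hs, rfl⟩ ⟨t, τ, ht, rfl⟩
    refine ⟨_, _, ?_, signedPerm_mul s t σ τ⟩
    simp [Finset.prod_mul_distrib, hs, Equiv.prod_comp σ t, ht]
  inv_mem' := by
    rintro _ ⟨s, σ, hs, rfl⟩
    refine ⟨s⁻¹ ∘ ⇑(σ⁻¹ : Perm (Fin 4)), σ⁻¹, ?_, ?_⟩
    · simpa [hs] using Equiv.prod_comp (σ⁻¹ : Perm (Fin 4)) s⁻¹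
    · rw [inv_eq_iff_mul_eq_one, signedPerm_mul, ← signedPerm_one]
      congr 1
      · ext i; simp
      · simp

theorem mem_evenSignedPerms {g : (Fin 4 → ℂ) ≃ₗ[ℂ] (Fin 4 → ℂ)} :
    g ∈ evenSignedPerms ↔ ∃ s σ, ∏ i, s i = 1 ∧ g = signedPerm s σ := Iff.rfl

/-- The sign vector with entries `-1` at two places `i ≠ j`. -/
def twoSigns (i j : Fin 4) : Fin 4 → ℤˣ := Pi.mulSingle i (-1) * Pi.mulSingle j (-1)

theorem prod_twoSigns (i j : Fin 4) : ∏ k, twoSigns i j k = 1 := by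
  simp [twoSigns, Finset.prod_mul_distrib]

/-- The even signed permutations are generated by three transpositions that connect all four
coordinates and a single change of two signs. -/
theorem evenSignedPerms_le {K : Subgroup ((Fin 4 → ℂ) ≃ₗ[ℂ] (Fin 4 → ℂ))}
    (h03 : signedPerm 1 (swap 0 3) ∈ K) (h12 : signedPerm 1 (swap 1 2) ∈ K)
    (h13 : signedPerm 1 (swap 1 3) ∈ K) (hs : signedPerm (twoSigns 0 3) 1 ∈ K) :
    evenSignedPerms ≤ K := by
  have hperm : ∀ σ, signedPerm 1 σ ∈ K := by
    let P : Subgroup (Perm (Fin 4)) :=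
      { carrier := {σ | signedPerm 1 σ ∈ K}
        one_mem' := by simp [signedPerm_one, K.one_mem]
        mul_mem' := by
          intro σ τ hσ hτ
          have := K.mul_mem hτ hσ
          rwa [signedPerm_mul,
            show (1 : Fin 4 → ℤˣ) * (1 : Fin 4 → ℤˣ) ∘ τ = 1 by ext; simp] at this
        inv_mem' := by
          intro σ hσ
          have h := K.inv_mem hσ
          have : (signedPerm 1 σ)⁻¹ = signedPerm 1 σ⁻¹ := by
            rw [inv_eq_iff_mul_eq_one, signedPerm_mul, ← signedPerm_one]
            congr 1
            simp
          rwa [this] at h }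
    have h3 : ∀ i, swap i 3 ∈ P := by
      intro i
      fin_cases i
      · exact h03
      · exact h13
      · refine SubmonoidClass.swap_mem_trans P ?_ (show swap 1 3 ∈ P from h13)
        rw [swap_comm]
        exact h12
      · exact swap_self (3 : Fin 4) ▸ P.one_mem
    have hP : P = ⊤ := by
      rw [← top_le_iff, ← Perm.closure_isSwap, Subgroup.closure_le]
      rintro _ ⟨i, j, -, rfl⟩
      exact SubmonoidClass.swap_mem_trans P (h3 i) (swap_comm j 3 ▸ h3 j)
    intro σ
    have : σ ∈ P := hP ▸ Subgroup.mem_top σ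
    exact this
  let Q : Subgroup (Fin 4 → ℤˣ) :=
    { carrier := {s | signedPerm s 1 ∈ K}
      one_mem' := by simp [signedPerm_one, K.one_mem]
      mul_mem' := by
        intro s t hs ht
        have := K.mul_mem hs ht
        rwa [signedPerm_mul] at this
      inv_mem' := by
        intro s hs
        rwa [show s⁻¹ = s by ext; simp] }
  have hcomp : ∀ s ∈ Q, ∀ σ : Perm (Fin 4), s ∘ σ ∈ Q := by
    intro s hs σ
    have := K.mul_mem (K.mul_mem (hperm σ) hs) (hperm σ⁻¹)
    rw [signedPerm_mul, signedPerm_mul] at this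
    have he : (1 * s ∘ σ * (1 : Fin 4 → ℤˣ) ∘ ⇑(1 * σ)) = s ∘ σ := by ext; simp
    rwa [he, one_mul, inv_mul_cancel] at this
  have hpair : ∀ i : Fin 4, i ≠ 3 → twoSigns i 3 ∈ Q := by
    intro i hi
    convert hcomp _ hs (swap 0 i) using 1
    revert i
    decide
  rintro _ ⟨s, σ, hprod, rfl⟩
  have hsQ : s ∈ Q := by
    -- Pair every sign with a copy of itself at the last place; these copies multiply to `1`.
    have : s = ∏ i, (Pi.mulSingle i (s i) * Pi.mulSingle 3 (s i)) := by
      rw [Finset.prod_mul_distrib, Finset.univ_prod_mulSingle]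
      have : ∏ i, (Pi.mulSingle 3 (s i) : Fin 4 → ℤˣ) = Pi.mulSingle 3 (∏ i, s i) :=
        (map_prod (MonoidHom.mulSingle (fun _ : Fin 4 => ℤˣ) 3) s Finset.univ).symm
      rw [this, hprod, Pi.mulSingle_one, mul_one]
    rw [this]
    refine Q.prod_mem fun i _ => ?_
    rcases Int.units_eq_one_or (s i) with h | h
    · simp [h, Q.one_mem]
    · rw [h]
      by_cases hi : i = 3
      · rw [hi, ← Pi.mulSingle_mul]
        simp [Q.one_mem]
      · exact hpair i hi
  have := K.mul_mem hsQ (hperm σ)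
  rw [signedPerm_mul] at this
  simpa using this

theorem coeffSymmetries_eq : coeffSymmetries = evenSignedPerms := by
  apply le_antisymm
  · refine (Subgroup.closure_le _).2 ?_
    rintro g (⟨σ, hσ⟩ | ⟨i, j, hij, h⟩)
    · refine ⟨1, σ, by simp, ?_⟩
      ext1 v
      funext k
      simp [hσ]
    · refine ⟨twoSigns i j, 1, prod_twoSigns i j, ?_⟩
      ext1 v
      funext k
      rw [h, signedPerm_apply, twoSigns]
      by_cases hi : k = i
      · subst hi; simp [hij, Units.smul_def]
      · by_cases hj : k = j
        · subst hj; simp [hi, Units.smul_def]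
        · simp [hi, hj]
  · have hp : ∀ σ, signedPerm 1 σ ∈ coeffSymmetries := fun σ =>
      Subgroup.subset_closure (Or.inl ⟨σ, fun v i => by simp⟩)
    refine evenSignedPerms_le (hp _) (hp _) (hp _)
      (Subgroup.subset_closure (Or.inr ⟨0, 3, by decide, fun v k => ?_⟩))
    fin_cases k <;> simp [twoSigns, Units.smul_def]

/-- The reflection in `s eᵢ + t eⱼ` exchanges the coordinates `i` and `j`, with the sign `-st`. -/
theorem signedPerm_eq_reflection {i j : Fin 4} (hij : i ≠ j) (s t : ℤˣ) (v : Fin 4 → ℂ) :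
    signedPerm (Pi.mulSingle i (-(s * t)) * Pi.mulSingle j (-(s * t))) (swap i j) v =
      v - ((Pi.single i ((s : ℤ) : ℂ) + Pi.single j ((t : ℤ) : ℂ)) ⬝ᵥ v) •
        (Pi.single i ((s : ℤ) : ℂ) + Pi.single j ((t : ℤ) : ℂ) : Fin 4 → ℂ) := by
  have hs : ((s : ℤ) : ℂ) * ((s : ℤ) : ℂ) = 1 := by
    rcases Int.units_eq_one_or s with rfl | rfl <;> simp
  have ht : ((t : ℤ) : ℂ) * ((t : ℤ) : ℂ) = 1 := by
    rcases Int.units_eq_one_or t with rfl | rfl <;> simp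
  funext k
  by_cases hi : k = i
  · subst hi
    simp [hij, Units.smul_def, add_dotProduct]
    linear_combination v k * hs
  · by_cases hj : k = j
    · subst hj
      simp [hi, Units.smul_def, add_dotProduct]
      linear_combination v k * ht
    · simp [hi, hj, swap_apply_of_ne_of_ne]

theorem weylGroupD4_eq : weylGroupD4 = evenSignedPerms := by
  apply le_antisymm
  · refine (Subgroup.closure_le _).2 ?_
    rintro g ⟨_, ⟨i, j, hij, s, t, hs, ht, rfl⟩, hg⟩
    obtain ⟨s, rfl⟩ : ∃ u : ℤˣ, ((u : ℤ) : ℂ) = s := by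
      rcases hs with rfl | rfl
      exacts [⟨1, by simp⟩, ⟨-1, by simp⟩]
    obtain ⟨t, rfl⟩ : ∃ u : ℤˣ, ((u : ℤ) : ℂ) = t := by
      rcases ht with rfl | rfl
      exacts [⟨1, by simp⟩, ⟨-1, by simp⟩]
    refine ⟨Pi.mulSingle i (-(s * t)) * Pi.mulSingle j (-(s * t)), swap i j, ?_, ?_⟩
    · simp [Finset.prod_mul_distrib]
    · ext1 v
      rw [hg, signedPerm_eq_reflection hij]
  · have hr : ∀ i j : Fin 4, i ≠ j → ∀ s t : ℤˣ,
        signedPerm (Pi.mulSingle i (-(s * t)) * Pi.mulSingle j (-(s * t))) (swap i j) ∈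
          weylGroupD4 := by
      intro i j hij s t
      refine Subgroup.subset_closure ⟨_, ⟨i, j, hij, s, t, ?_, ?_, rfl⟩,
        signedPerm_eq_reflection hij s t⟩
      · rcases Int.units_eq_one_or s with rfl | rfl <;> simp
      · rcases Int.units_eq_one_or t with rfl | rfl <;> simp
    have hp : ∀ i j : Fin 4, i ≠ j → signedPerm 1 (swap i j) ∈ weylGroupD4 := by
      intro i j hij
      simpa using hr i j hij 1 (-1)
    refine evenSignedPerms_le (hp _ _ (by decide)) (hp _ _ (by decide)) (hp _ _ (by decide)) ?_
    have := weylGroupD4.mul_mem (hr 0 3 (by decide) 1 1) (hp 0 3 (by decide))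
    rw [signedPerm_mul] at this
    simpa [twoSigns] using this

/-- The stabiliser of a vector with distinct squares of coordinates is trivial, so its orbit has as
many elements as the group. -/
theorem ncard_orbit {v : Fin 4 → ℂ} (hv : Function.Injective fun i => v i ^ 2) :
    {v' : Fin 4 → ℂ | ∃ w ∈ evenSignedPerms, v' = w v}.ncard = 192 := by
  let S : Finset ((Fin 4 → ℤˣ) × Perm (Fin 4)) :=
    (Finset.univ.filter fun s => ∏ i, s i = 1) ×ˢ Finset.univ
  have hS : S.card = 192 := by
    rw [Finset.card_product, Finset.card_univ, Fintype.card_perm]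
    have : (Finset.univ.filter fun s : Fin 4 → ℤˣ => ∏ i, s i = 1).card = 8 := by decide
    rw [this]
    rfl
  have himage : {v' : Fin 4 → ℂ | ∃ w ∈ evenSignedPerms, v' = w v} =
      (fun p : (Fin 4 → ℤˣ) × Perm (Fin 4) => signedPerm p.1 p.2 v) '' S := by
    ext v'
    simp only [S, Set.mem_ofPred_eq, mem_evenSignedPerms, Set.mem_image, Finset.mem_coe,
      Finset.mem_product, Finset.mem_filter, Finset.mem_univ, true_and, and_true, Prod.exists]
    constructor
    · rintro ⟨_, ⟨s, σ, hs, rfl⟩, rfl⟩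
      exact ⟨s, σ, hs, rfl⟩
    · rintro ⟨s, σ, hs, rfl⟩
      exact ⟨_, ⟨s, σ, hs, rfl⟩, rfl⟩
  rw [himage, Set.InjOn.ncard_image, Set.ncard_coe_finset, hS]
  rintro ⟨s, σ⟩ h₁ ⟨t, τ⟩ h₂ h
  simp only [S, Finset.coe_product, Set.mem_prod, Finset.mem_coe, Finset.mem_filter,
    Finset.mem_univ, true_and, and_true] at h₁ h₂
  have h' : ∀ i, ((s i : ℤ) : ℂ) * v (σ i) = ((t i : ℤ) : ℂ) * v (τ i) := fun i => by
    simpa [Units.smul_def] using congrFun h i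
  have hsq : ∀ u : ℤˣ, ((u : ℤ) : ℂ) ^ 2 = 1 := fun u => by
    rcases Int.units_eq_one_or u with rfl | rfl <;> simp
  have hστ : σ = τ := by
    ext1 i
    apply hv
    have := congrArg (· ^ 2) (h' i)
    simpa [mul_pow, hsq] using this
  subst hστ
  have hne : ∀ i, v (σ i) ≠ 0 → s i = t i := by
    intro i hi
    have := mul_right_cancel₀ hi (h' i)
    exact Units.ext (by exact_mod_cast this)
  -- At most one coordinate of `v` vanishes; its sign is determined by the others.
  have hst : s = t := by
    by_cases h0 : ∃ i, v (σ i) = 0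
    · obtain ⟨i, hi⟩ := h0
      have hoff : ∀ k, k ≠ i → s k = t k := fun k hk => hne k fun h0 =>
        hk (σ.injective (hv (by simp [hi, h0])))
      funext k
      by_cases hk : k = i
      · subst hk
        have hp := h₁.trans h₂.symm
        rw [← Finset.mul_prod_erase _ _ (Finset.mem_univ k),
          ← Finset.mul_prod_erase _ t (Finset.mem_univ k),
          Finset.prod_congr rfl fun l hl => hoff l (Finset.ne_of_mem_erase hl)] at hp
        exact mul_right_cancel hp
      · exact hoff k hk
    · push Not at h0
      exact funext fun i => hne i (h0 i)
  rw [hst]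

/-! ### Local operators that realise the signed permutations -/

theorem tensorMatrix_mul {n : ℕ} (A B : Fin n → Matrix (Fin 2) (Fin 2) ℂ) :
    tensorMatrix (fun k => A k * B k) = tensorMatrix A * tensorMatrix B := by
  ext j i
  simp only [tensorMatrix, Matrix.of_apply, Matrix.mul_apply, Finset.prod_univ_sum,
    Fintype.piFinset_univ, Finset.prod_mul_distrib]

theorem tensorMatrix_one {n : ℕ} :
    tensorMatrix (fun _ : Fin n => (1 : Matrix (Fin 2) (Fin 2) ℂ)) = 1 := by
  ext j i
  simp only [tensorMatrix, Matrix.of_apply, Matrix.one_apply, Finset.prod_boole,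
    Finset.mem_univ, true_imp_iff, funext_iff]

theorem localAct_mul {n : ℕ} (A B : Fin n → Matrix.SpecialLinearGroup (Fin 2) ℂ) (ψ : Ket n) :
    localAct (A * B) ψ = localAct A (localAct B ψ) := by
  simp [localAct, tensorMatrix_mul, Matrix.mulVec_mulVec]

theorem localAct_one {n : ℕ} (ψ : Ket n) : localAct 1 ψ = ψ := by
  simp [localAct, tensorMatrix_one]

theorem localAct_add {n : ℕ} (A : Fin n → Matrix.SpecialLinearGroup (Fin 2) ℂ) (ψ φ : Ket n) :
    localAct A (ψ + φ) = localAct A ψ + localAct A φ := by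
  simp [localAct, Matrix.mulVec_add]

theorem localAct_smul {n : ℕ} (A : Fin n → Matrix.SpecialLinearGroup (Fin 2) ℂ) (c : ℂ)
    (ψ : Ket n) : localAct A (c • ψ) = c • localAct A ψ := by
  simp [localAct, Matrix.mulVec_smul]

theorem localAct_basisKet {n : ℕ} (A : Fin n → Matrix.SpecialLinearGroup (Fin 2) ℂ)
    (i j : Fin n → Fin 2) :
    localAct A (basisKet i) j = ∏ k, (A k : Matrix (Fin 2) (Fin 2) ℂ) (j k) (i k) := by
  simp [localAct, basisKet, tensorMatrix, EuclideanSpace.single]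

theorem gState_smul (c : ℂ) (v : Fin 4 → ℂ) : gState (c • v) = c • gState v := by
  simp only [gState, Pi.smul_apply, smul_eq_mul, smul_add, smul_smul]
  congr 1 <;> [congr 1; skip] <;> [congr 1; skip; skip] <;> congr 2 <;> ring

/-- The subgroup of linear maps of the coefficients that local `SL(2, ℂ)` operators induce on all
states `|G_abcd⟩` at once. -/
def locallyRealized : Subgroup ((Fin 4 → ℂ) ≃ₗ[ℂ] (Fin 4 → ℂ)) where
  carrier := {g | ∃ A : Fin 4 → Matrix.SpecialLinearGroup (Fin 2) ℂ,
    ∀ v, gState (g v) = localAct A (gState v)}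
  one_mem' := ⟨1, fun v => by simp [localAct_one]⟩
  mul_mem' := by
    rintro g h ⟨A, hA⟩ ⟨B, hB⟩
    exact ⟨A * B, fun v => by rw [localAct_mul, LinearEquiv.mul_apply, hA, hB]⟩
  inv_mem' := by
    rintro g ⟨A, hA⟩
    refine ⟨A⁻¹, fun v => ?_⟩
    have h : g (g⁻¹ v) = v := by rw [← LinearEquiv.mul_apply, mul_inv_cancel]; rfl
    conv_rhs => rw [← h, hA, ← localAct_mul, inv_mul_cancel, localAct_one]

theorem ket_ext {ψ φ : Ket 4} (h : ∀ a b c d : Fin 2, ψ ![a, b, c, d] = φ ![a, b, c, d]) :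
    ψ = φ := by
  ext i
  have : i = ![i 0, i 1, i 2, i 3] := by ext k; fin_cases k <;> rfl
  rw [this]
  exact h _ _ _ _

theorem localAct_gState_apply (A : Fin 4 → Matrix.SpecialLinearGroup (Fin 2) ℂ) (v : Fin 4 → ℂ)
    (j : Fin 4 → Fin 2) : localAct A (gState v) j =
      (v 0 + v 3) / 2 * (A 0 (j 0) 0 * A 1 (j 1) 0 * A 2 (j 2) 0 * A 3 (j 3) 0 +
        A 0 (j 0) 1 * A 1 (j 1) 1 * A 2 (j 2) 1 * A 3 (j 3) 1) +
      (v 0 - v 3) / 2 * (A 0 (j 0) 0 * A 1 (j 1) 0 * A 2 (j 2) 1 * A 3 (j 3) 1 +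
        A 0 (j 0) 1 * A 1 (j 1) 1 * A 2 (j 2) 0 * A 3 (j 3) 0) +
      (v 1 + v 2) / 2 * (A 0 (j 0) 0 * A 1 (j 1) 1 * A 2 (j 2) 0 * A 3 (j 3) 1 +
        A 0 (j 0) 1 * A 1 (j 1) 0 * A 2 (j 2) 1 * A 3 (j 3) 0) +
      (v 1 - v 2) / 2 * (A 0 (j 0) 0 * A 1 (j 1) 1 * A 2 (j 2) 1 * A 3 (j 3) 0 +
        A 0 (j 0) 1 * A 1 (j 1) 0 * A 2 (j 2) 0 * A 3 (j 3) 1) := by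
  simp only [gState, localAct_add, localAct_smul, PiLp.add_apply, PiLp.smul_apply, smul_eq_mul,
    localAct_basisKet, Fin.prod_univ_four]
  rfl

theorem gState_apply (v : Fin 4 → ℂ) (a b c d : Fin 2) : gState v ![a, b, c, d] =
    if a = b then
      if c = d then if a = c then (v 0 + v 3) / 2 else (v 0 - v 3) / 2 else 0
    else
      if c = d then 0 else if a = c then (v 1 + v 2) / 2 else (v 1 - v 2) / 2 := by
  rw [← localAct_one (gState v), localAct_gState_apply]
  fin_cases a <;> fin_cases b <;> fin_cases c <;> fin_cases d <;> simp

/-- The diagonal matrix `diag(x, y)` of determinant `xy = 1`. -/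
def phaseGate (x y : ℂ) (h : x * y = 1) : Matrix.SpecialLinearGroup (Fin 2) ℂ :=
  ⟨!![x, 0; 0, y], by simp [Matrix.det_fin_two, h]⟩

/-- The Hadamard gate, rescaled by `z` with `-2z² = 1` so that its determinant is `1`. -/
def hadamardGate (z : ℂ) (h : z ^ 2 = -1 / 2) : Matrix.SpecialLinearGroup (Fin 2) ℂ :=
  ⟨!![z, z; z, -z], by rw [Matrix.det_fin_two]; simp; linear_combination -2 * h⟩

/-- A primitive eighth root of unity and its inverse. -/
theorem exists_primitive_phase : ∃ x y : ℂ, x * y = 1 ∧ x ^ 4 = -1 ∧ y ^ 4 = -1 := by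
  obtain ⟨x, hx⟩ := IsAlgClosed.exists_pow_nat_eq (-1 : ℂ) (n := 4) (by norm_num)
  have hx0 : x ≠ 0 := by rintro rfl; norm_num at hx
  exact ⟨x, x⁻¹, mul_inv_cancel₀ hx0, hx, by rw [inv_pow, hx]; norm_num⟩

/-- A pair of equal phase gates exchanges `Φ⁺` and `Φ⁻` up to a square root of `-1` and fixes `Ψ±`.
The inverse gates on the second pair contribute the inverse scalar, so that `a` and `d` are
exchanged without a sign. -/
theorem swap_zero_three_mem : signedPerm 1 (swap 0 3) ∈ locallyRealized := by
  obtain ⟨x, y, hxy, hx, hy⟩ := exists_primitive_phase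
  have hyx : y * x = 1 := by rw [mul_comm, hxy]
  refine ⟨![phaseGate x y hxy, phaseGate x y hxy, phaseGate y x hyx, phaseGate y x hyx],
    fun v => ket_ext fun a b c d => ?_⟩
  rw [gState_apply, localAct_gState_apply]
  fin_cases a <;> fin_cases b <;> fin_cases c <;> fin_cases d <;>
    simp [phaseGate, swap_apply_of_ne_of_ne] <;> grind

/-- As `swap_zero_three_mem`, with opposite gates within each pair, which exchanges `Ψ⁺` and `Ψ⁻`
instead. -/
theorem swap_one_two_mem : signedPerm 1 (swap 1 2) ∈ locallyRealized := by
  obtain ⟨x, y, hxy, hx, hy⟩ := exists_primitive_phase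
  have hyx : y * x = 1 := by rw [mul_comm, hxy]
  refine ⟨![phaseGate x y hxy, phaseGate y x hyx, phaseGate y x hyx, phaseGate x y hxy],
    fun v => ket_ext fun a b c d => ?_⟩
  rw [gState_apply, localAct_gState_apply]
  fin_cases a <;> fin_cases b <;> fin_cases c <;> fin_cases d <;>
    simp [phaseGate, swap_apply_of_ne_of_ne] <;> grind

/-- Hadamard gates on both qubits of a pair fix `Φ⁺`, exchange `Φ⁻` and `Ψ⁺`, and negate `Ψ⁻`; the
signs of the two pairs cancel, and so do the scalars that normalise the determinants. -/
theorem swap_one_three_mem : signedPerm 1 (swap 1 3) ∈ locallyRealized := by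
  obtain ⟨z, hz⟩ := IsAlgClosed.exists_pow_nat_eq (-1 / 2 : ℂ) (n := 2) (by norm_num)
  refine ⟨fun _ => hadamardGate z hz, fun v => ket_ext fun a b c d => ?_⟩
  have hz4 : z * z * z * z = 1 / 4 := by linear_combination (z ^ 2 - 1 / 2) * hz
  rw [gState_apply, localAct_gState_apply]
  fin_cases a <;> fin_cases b <;> fin_cases c <;> fin_cases d <;>
    simp [hadamardGate, swap_apply_of_ne_of_ne, hz4] <;> ring

/-- The operator `iZ ⊗ iZ` on the first pair alone negates `Φ±` and fixes `Ψ±`. -/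
theorem twoSigns_zero_three_mem : signedPerm (twoSigns 0 3) 1 ∈ locallyRealized := by
  have h : Complex.I * -Complex.I = 1 := by simp
  refine ⟨![phaseGate _ _ h, phaseGate _ _ h, 1, 1], fun v => ket_ext fun a b c d => ?_⟩
  rw [gState_apply, localAct_gState_apply]
  fin_cases a <;> fin_cases b <;> fin_cases c <;> fin_cases d <;>
    simp [phaseGate, twoSigns, Units.smul_def] <;> ring

theorem evenSignedPerms_le_locallyRealized : evenSignedPerms ≤ locallyRealized :=
  evenSignedPerms_le swap_zero_three_mem swap_one_two_mem swap_one_three_mem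
    twoSigns_zero_three_mem

/-! ### Invariants of local operators -/

/-- The coefficient matrix of a four-qubit state across the cut `12 | 34`. -/
def cutMatrix (ψ : Ket 4) : Matrix (Fin 2 × Fin 2) (Fin 2 × Fin 2) ℂ :=
  Matrix.of fun p q => ψ ![p.1, p.2, q.1, q.2]

/-- The splitting of a bit string of length four into two pairs of bits. -/
def splitBits : (Fin 2 × Fin 2) × (Fin 2 × Fin 2) ≃ (Fin 4 → Fin 2) where
  toFun p := ![p.1.1, p.1.2, p.2.1, p.2.2]
  invFun i := ((i 0, i 1), (i 2, i 3))
  left_inv _ := rfl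
  right_inv i := by ext k; fin_cases k <;> rfl

theorem cutMatrix_localAct (A : Fin 4 → Matrix.SpecialLinearGroup (Fin 2) ℂ) (ψ : Ket 4) :
    cutMatrix (localAct A ψ) =
      ((A 0 : Matrix (Fin 2) (Fin 2) ℂ) ⊗ₖ (A 1 : Matrix (Fin 2) (Fin 2) ℂ)) * cutMatrix ψ *
        ((A 2 : Matrix (Fin 2) (Fin 2) ℂ) ⊗ₖ (A 3 : Matrix (Fin 2) (Fin 2) ℂ))ᵀ := by
  ext p q
  simp only [cutMatrix, localAct, Matrix.of_apply, Matrix.mulVec, dotProduct, Matrix.mul_apply,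
    tensorMatrix, Finset.sum_mul, ← splitBits.sum_comp]
  rw [Fintype.sum_prod_type, Finset.sum_comm]
  refine Finset.sum_congr rfl fun r _ => Finset.sum_congr rfl fun s _ => ?_
  have h : splitBits (s, r) = ![s.1, s.2, r.1, r.2] := rfl
  simp [h, Fin.prod_univ_four, Matrix.kroneckerMap_apply]
  ring

/-- The matrix of the symplectic form on one qubit that `SL(2, ℂ)` preserves. -/
def spinForm : Matrix (Fin 2) (Fin 2) ℂ := !![0, 1; -1, 0]

theorem transpose_mul_spinForm_mul (A : Matrix.SpecialLinearGroup (Fin 2) ℂ) :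
    (A : Matrix (Fin 2) (Fin 2) ℂ)ᵀ * spinForm * A = spinForm := by
  have h := A.det_coe
  rw [Matrix.det_fin_two] at h
  ext i j
  fin_cases i <;> fin_cases j <;>
    simp [spinForm, Matrix.mul_apply, Fin.sum_univ_two] <;> grind

/-- The matrix of the symmetric bilinear form on two qubits that `SL(2, ℂ) ⊗ SL(2, ℂ)`
preserves. -/
def pairForm : Matrix (Fin 2 × Fin 2) (Fin 2 × Fin 2) ℂ := spinForm ⊗ₖ spinForm

theorem transpose_mul_pairForm_mul (A B : Matrix.SpecialLinearGroup (Fin 2) ℂ) :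
    ((A : Matrix (Fin 2) (Fin 2) ℂ) ⊗ₖ (B : Matrix (Fin 2) (Fin 2) ℂ))ᵀ * pairForm *
      ((A : Matrix (Fin 2) (Fin 2) ℂ) ⊗ₖ (B : Matrix (Fin 2) (Fin 2) ℂ)) = pairForm := by
  rw [pairForm, ← Matrix.kroneckerMap_transpose, ← Matrix.mul_kronecker_mul,
    ← Matrix.mul_kronecker_mul, transpose_mul_spinForm_mul, transpose_mul_spinForm_mul]

theorem det_cutMatrix_localAct (A : Fin 4 → Matrix.SpecialLinearGroup (Fin 2) ℂ) (ψ : Ket 4) :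
    (cutMatrix (localAct A ψ)).det = (cutMatrix ψ).det := by
  simp [cutMatrix_localAct, Matrix.det_kronecker]

/-- Under `M ↦ P M Qᵀ` with `P`, `Q` preserving the form `J`, the matrix `M J Mᵀ J` is conjugated
by `P`. -/
theorem charpoly_cutMatrix_localAct (A : Fin 4 → Matrix.SpecialLinearGroup (Fin 2) ℂ)
    (ψ : Ket 4) :
    (cutMatrix (localAct A ψ) * pairForm * (cutMatrix (localAct A ψ))ᵀ * pairForm).charpoly =
      (cutMatrix ψ * pairForm * (cutMatrix ψ)ᵀ * pairForm).charpoly := by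
  rw [cutMatrix_localAct]
  have hP := transpose_mul_pairForm_mul (A 0) (A 1)
  have hQ := transpose_mul_pairForm_mul (A 2) (A 3)
  set P := (A 0 : Matrix (Fin 2) (Fin 2) ℂ) ⊗ₖ (A 1 : Matrix (Fin 2) (Fin 2) ℂ)
  set Q := (A 2 : Matrix (Fin 2) (Fin 2) ℂ) ⊗ₖ (A 3 : Matrix (Fin 2) (Fin 2) ℂ)
  set M := cutMatrix ψ
  calc (P * M * Qᵀ * pairForm * (P * M * Qᵀ)ᵀ * pairForm).charpoly
      = (P * (M * (Qᵀ * pairForm * Q) * Mᵀ * Pᵀ * pairForm)).charpoly := by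
        simp only [Matrix.transpose_mul, Matrix.transpose_transpose, Matrix.mul_assoc]
    _ = (M * (Qᵀ * pairForm * Q) * Mᵀ * (Pᵀ * pairForm * P)).charpoly := by
        rw [Matrix.charpoly_mul_comm]
        simp only [Matrix.mul_assoc]
    _ = (M * pairForm * Mᵀ * pairForm).charpoly := by rw [hP, hQ]

/-- The Bell vectors `Φ⁺, Ψ⁺, Ψ⁻, Φ⁻`, without the factor `1/√2`, as columns. -/
def bellMatrix : Matrix (Fin 2 × Fin 2) (Fin 4) ℂ :=
  Matrix.of fun p => if p.1 = p.2 then ![1, 0, 0, if p.1 = 0 then 1 else -1]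
    else ![0, 1, if p.1 = 0 then 1 else -1, 0]

theorem bellMatrix_transpose_mul : (1 / 2 : ℂ) • bellMatrixᵀ * bellMatrix = 1 := by
  ext i j
  fin_cases i <;> fin_cases j <;>
    simp [bellMatrix, Matrix.mul_apply, Fintype.sum_prod_type, Fin.sum_univ_two] <;> norm_num

theorem bellMatrix_mul_transpose : bellMatrix * ((1 / 2 : ℂ) • bellMatrixᵀ) = 1 := by
  ext ⟨a, b⟩ ⟨c, d⟩
  fin_cases a <;> fin_cases b <;> fin_cases c <;> fin_cases d <;>
    simp [bellMatrix, Matrix.mul_apply, Fin.sum_univ_four] <;> norm_num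

theorem cutMatrix_gState (v : Fin 4 → ℂ) :
    cutMatrix (gState v) = bellMatrix * Matrix.diagonal v * ((1 / 2 : ℂ) • bellMatrixᵀ) := by
  ext ⟨a, b⟩ ⟨c, d⟩
  rw [cutMatrix, Matrix.of_apply, gState_apply]
  fin_cases a <;> fin_cases b <;> fin_cases c <;> fin_cases d <;>
    simp [bellMatrix, Matrix.mul_apply, Fin.sum_univ_four, Matrix.diagonal_apply] <;> ring

theorem pairForm_eq :
    pairForm = bellMatrix * Matrix.diagonal (![1, -1, 1, -1] : Fin 4 → ℂ) *
      ((1 / 2 : ℂ) • bellMatrixᵀ) := by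
  ext ⟨a, b⟩ ⟨c, d⟩
  fin_cases a <;> fin_cases b <;> fin_cases c <;> fin_cases d <;>
    simp [pairForm, spinForm, bellMatrix, Matrix.mul_apply, Fin.sum_univ_four,
      Matrix.diagonal_apply] <;> norm_num

theorem cutMatrix_mul_form (v : Fin 4 → ℂ) :
    cutMatrix (gState v) * pairForm * (cutMatrix (gState v))ᵀ * pairForm =
      bellMatrix * Matrix.diagonal (fun i => v i ^ 2) * ((1 / 2 : ℂ) • bellMatrixᵀ) := by
  have hconj : ∀ D E : Matrix (Fin 4) (Fin 4) ℂ,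
      bellMatrix * D * ((1 / 2 : ℂ) • bellMatrixᵀ) *
        (bellMatrix * E * ((1 / 2 : ℂ) • bellMatrixᵀ)) =
      bellMatrix * (D * E) * ((1 / 2 : ℂ) • bellMatrixᵀ) := fun D E => by
    rw [← Matrix.mul_assoc, ← Matrix.mul_assoc, Matrix.mul_assoc (bellMatrix * D) _ bellMatrix,
      bellMatrix_transpose_mul, Matrix.mul_one, Matrix.mul_assoc bellMatrix D E]
  have hsymm : (cutMatrix (gState v))ᵀ = cutMatrix (gState v) := by
    simp [cutMatrix_gState, Matrix.transpose_mul, Matrix.mul_assoc]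
  rw [hsymm, cutMatrix_gState, pairForm_eq, hconj, hconj, hconj]
  congr 2
  simp only [Matrix.diagonal_mul_diagonal]
  congr 1
  ext i
  fin_cases i <;> simp <;> ring

theorem charpoly_cutMatrix_gState (v : Fin 4 → ℂ) :
    (cutMatrix (gState v) * pairForm * (cutMatrix (gState v))ᵀ * pairForm).charpoly =
      ∏ i, (X - C (v i ^ 2)) := by
  rw [cutMatrix_mul_form, Matrix.mul_assoc]
  have h := Matrix.charpoly_mul_comm' bellMatrix
    (Matrix.diagonal (fun i => v i ^ 2) * ((1 / 2 : ℂ) • bellMatrixᵀ))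
  rw [Matrix.mul_assoc _ _ bellMatrix, bellMatrix_transpose_mul, Matrix.mul_one,
    Matrix.charpoly_diagonal] at h
  exact (isRegular_X_pow _).left.eq_iff.mp h

theorem det_cutMatrix_gState (v : Fin 4 → ℂ) : (cutMatrix (gState v)).det = ∏ i, v i := by
  rw [cutMatrix_gState,
    Matrix.det_conj_of_mul_eq_one bellMatrix_mul_transpose bellMatrix_transpose_mul,
    Matrix.det_diagonal]

/-! ### Classification of the states `|G_abcd⟩` up to local operators -/

/-- Vectors with the same squares up to order and the same product of coordinates are related by
an even signed permutation. -/
theorem exists_evenSignedPerm_of_invariants {v v' : Fin 4 → ℂ}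
    (hpoly : ∏ i, (X - C (v' i ^ 2)) = ∏ i, (X - C (v i ^ 2)))
    (hprod : ∏ i, v' i = ∏ i, v i) : ∃ w ∈ evenSignedPerms, v' = w v := by
  have hm : Finset.univ.val.map (fun i => v' i ^ 2) = Finset.univ.val.map fun i => v i ^ 2 := by
    rw [← roots_multiset_prod_X_sub_C (Finset.univ.val.map fun i => v' i ^ 2),
      ← roots_multiset_prod_X_sub_C (Finset.univ.val.map fun i => v i ^ 2),
      Multiset.map_map, Multiset.map_map]
    exact congrArg roots hpoly
  obtain ⟨σ, hσ⟩ : ∃ σ : Perm (Fin 4), ∀ i, v' i ^ 2 = v (σ i) ^ 2 := by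
    have hcard : ∀ y, Fintype.card {i // v' i ^ 2 = y} = Fintype.card {i // v i ^ 2 = y} := by
      intro y
      have h := congrArg (Multiset.count y) hm
      rw [Multiset.count_map, Multiset.count_map] at h
      rw [Fintype.card_subtype, Fintype.card_subtype]
      simp only [eq_comm (a := y)] at h
      exact h
    let e : ∀ y, {i // v' i ^ 2 = y} ≃ {i // v i ^ 2 = y} := fun y =>
      Fintype.equivOfCardEq (hcard y)
    exact ⟨Equiv.ofFiberEquiv (f := fun i => v' i ^ 2) (g := fun i => v i ^ 2) e,
      fun i => (Equiv.ofFiberEquiv_map (f := fun i => v' i ^ 2) (g := fun i => v i ^ 2) e i).symm⟩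
  have hs : ∀ i, ∃ s : ℤˣ, v' i = s • v (σ i) := fun i => by
    rcases sq_eq_sq_iff_eq_or_eq_neg.1 (hσ i) with h | h
    exacts [⟨1, by simpa⟩, ⟨-1, by simpa [Units.smul_def]⟩]
  choose s hs using hs
  rcases Int.units_eq_one_or (∏ i, s i) with h1 | h1
  · exact ⟨_, ⟨s, σ, h1, rfl⟩, funext hs⟩
  · -- With an odd number of signs some coordinate vanishes, and its sign can be changed.
    have h0 : ∏ i, v i = 0 := by
      have h : ∏ i, v' i = (∏ i, s i) • ∏ i, v i := by
        rw [← Equiv.prod_comp σ v, ← Finset.prod_smul]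
        exact Finset.prod_congr rfl fun i _ => hs i
      rw [h1, hprod, Units.neg_smul, one_smul] at h
      exact self_eq_neg.1 h
    obtain ⟨j, -, hj⟩ := Finset.prod_eq_zero_iff.1 h0
    refine ⟨_, ⟨s * Pi.mulSingle (σ.symm j) (-1), σ, ?_, rfl⟩, funext fun i => ?_⟩
    · simp [Finset.prod_mul_distrib, h1]
    · rw [signedPerm_apply, hs]
      by_cases hi : i = σ.symm j
      · simp [hi, hj]
      · simp [hi]

/-- The states `|G_abcd⟩` in one orbit of the local operators. No condition on `v` is needed. -/
theorem exists_localAct_iff (v v' : Fin 4 → ℂ) :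
    (∃ A : Fin 4 → Matrix.SpecialLinearGroup (Fin 2) ℂ, gState v' = localAct A (gState v)) ↔
      ∃ w ∈ evenSignedPerms, v' = w v := by
  constructor
  · rintro ⟨A, hA⟩
    apply exists_evenSignedPerm_of_invariants
    · rw [← charpoly_cutMatrix_gState, ← charpoly_cutMatrix_gState, hA,
        charpoly_cutMatrix_localAct]
    · rw [← det_cutMatrix_gState, ← det_cutMatrix_gState, hA, det_cutMatrix_localAct]
  · rintro ⟨w, hw, rfl⟩
    obtain ⟨A, hA⟩ := evenSignedPerms_le_locallyRealized hw
    exact ⟨A, hA v⟩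

theorem norm_gState_sq (v : Fin 4 → ℂ) : ‖gState v‖ ^ 2 = ∑ i, ‖v i‖ ^ 2 := by
  have h1 := parallelogram_law_with_norm ℝ (v 0) (v 3)
  have h2 := parallelogram_law_with_norm ℝ (v 1) (v 2)
  rw [EuclideanSpace.norm_sq_eq, ← splitBits.sum_comp]
  have h : ∀ p, splitBits p = ![p.1.1, p.1.2, p.2.1, p.2.2] := fun _ => rfl
  simp [h, Fintype.sum_prod_type, gState_apply, Fin.sum_univ_four]
  linear_combination h1 / 2 + h2 / 2

theorem norm_gState_evenSignedPerm {w : (Fin 4 → ℂ) ≃ₗ[ℂ] (Fin 4 → ℂ)}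
    (hw : w ∈ evenSignedPerms) (v : Fin 4 → ℂ) : ‖gState (w v)‖ = ‖gState v‖ := by
  obtain ⟨s, σ, -, rfl⟩ := hw
  have hs : ∀ (u : ℤˣ) (z : ℂ), ‖u • z‖ = ‖z‖ := fun u z => by
    rcases Int.units_eq_one_or u with rfl | rfl <;> simp [Units.smul_def]
  rw [← sq_eq_sq₀ (norm_nonneg _) (norm_nonneg _), norm_gState_sq, norm_gState_sq,
    ← Equiv.sum_comp σ fun i => ‖v i‖ ^ 2]
  simp [hs]

/-- For states of equal nonzero norm, the scalar in a SLOCC equivalence has modulus one. -/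
theorem sloccEquiv_gState_iff {v v' : Fin 4 → ℂ} (hv : v ≠ 0)
    (hnorm : ‖gState v'‖ = ‖gState v‖) :
    SLOCCEquiv (gState v) (gState v') ↔
      ∃ θ : ℝ, ∃ w ∈ evenSignedPerms, v' = Complex.exp ((θ : ℂ) * Complex.I) • w v := by
  constructor
  · rintro ⟨A, κ, -, hA⟩
    obtain ⟨w, hw, rfl⟩ := (exists_localAct_iff (κ • v) v').1
      ⟨A, by rw [hA, gState_smul, localAct_smul]⟩
    rw [map_smul, gState_smul, norm_smul, norm_gState_evenSignedPerm hw] at hnorm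
    have h0 : ‖gState v‖ ≠ 0 := fun h => hv <| by
      have h' := norm_gState_sq v
      rw [h, zero_pow two_ne_zero, eq_comm,
        Finset.sum_eq_zero_iff_of_nonneg fun i _ => sq_nonneg _] at h'
      funext i
      simpa using h' i (Finset.mem_univ i)
    have hκ : ‖κ‖ = 1 := mul_right_cancel₀ h0 (hnorm.trans (one_mul _).symm)
    refine ⟨κ.arg, w, hw, ?_⟩
    have := Complex.norm_mul_exp_arg_mul_I κ
    rw [hκ, Complex.ofReal_one, one_mul] at this
    rw [this, map_smul]
  · rintro ⟨θ, w, hw, rfl⟩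
    obtain ⟨A, hA⟩ := (exists_localAct_iff v (w v)).2 ⟨w, hw, rfl⟩
    exact ⟨A, _, Complex.exp_ne_zero _, by rw [gState_smul, hA]⟩

end

end FourQubit

theorem proposition1 (v : Fin 4 → ℂ) (hv : Function.Injective fun i => v i ^ 2) :
    (∀ v' : Fin 4 → ℂ, ‖FourQubit.gState v'‖ = ‖FourQubit.gState v‖ →
      (FourQubit.SLOCCEquiv (FourQubit.gState v) (FourQubit.gState v') ↔
        ∃ θ : ℝ, ∃ w ∈ FourQubit.coeffSymmetries,
          v' = Complex.exp ((θ : ℂ) * Complex.I) • w v)) ∧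
    {v' : Fin 4 → ℂ | ∃ A : Fin 4 → Matrix.SpecialLinearGroup (Fin 2) ℂ,
        FourQubit.gState v' = FourQubit.localAct A (FourQubit.gState v)} =
      {v' | ∃ w ∈ FourQubit.coeffSymmetries, v' = w v} ∧
    {v' : Fin 4 → ℂ | ∃ w ∈ FourQubit.coeffSymmetries, v' = w v}.ncard = 192 ∧
    FourQubit.coeffSymmetries = FourQubit.weylGroupD4 := by
  rw [FourQubit.coeffSymmetries_eq, FourQubit.weylGroupD4_eq]
  have hv0 : v ≠ 0 := by
    rintro rfl
    exact zero_ne_one (hv rfl)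
  exact ⟨fun v' hnorm => FourQubit.sloccEquiv_gState_iff hv0 hnorm,
    Set.ext fun v' => FourQubit.exists_localAct_iff v v', FourQubit.ncard_orbit hv, rfl⟩
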